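/- Fix a first-order signature of function and predicate symbols (there is no identity symbol with special axioms). The terms and formulas of the quantifier-free language $L_\varepsilon$ are defined simultaneously: terms are built from variables, function symbols and $\varepsilon$-terms $\varepsilon_x A$, where $A$ is a formula in which $x$ occurs free; formulas are built from atomic formulas $P(t_1,\dots,t_k)$, $\top$ and $\bot$ by $\neg,\wedge,\vee,\to,\leftrightarrow$. Expressions are identified up to renaming of bound variables. The language $L$ consists of the terms and formulas in which $\varepsilon$ does not occur. The elementary calculus $\mathrm{EC}$ has as axioms all propositional tautologies of $L$, and modus ponens as its only rule. The $\varepsilon$-calculus $\mathrm{EC}_\varepsilon$ has as axioms all propositional tautologies of $L_\varepsilon$ and all critical formulas $A(t)\to A(\varepsilon_x A(x))$, where $\varepsilon_x A(x)$ and $t$ are terms of $L_\varepsilon$, and modus ponens as its only rule. A proof is a finite sequence of formulas each of which is an axiom or follows from two earlier members by modus ponens. **Theorem (Extended First $\varepsilon$-Theorem).** Let $n\ge 0$, let $E(x_1,\dots,x_n)$ be an $\varepsilon$-free formula (a formula of $L$) with pairwise distinct variables $x_1,\dots,x_n$ (it may contain further free variables), and let $e_1,\dots,e_n$ be $\varepsilon$-terms.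 If $E(e_1,\dots,e_n)$ is provable in $\mathrm{EC}_\varepsilon$, then there are $m\ge 1$ and $\varepsilon$-free terms $t_i^j$ ($1\le i\le n$, $1\le j\le m$) such that $$\bigvee_{j=1}^m E(t_1^j,\dots,t_n^j)$$ is provable in $\mathrm{EC}$. Here $E(s_1,\dots,s_n)$ denotes the result of simultaneously substituting $s_i$ for $x_i$, $i=1,\dots,n$. -/

import Mathlib

universe u v

namespace EpsCalc

/- Terms and formulas of the quantifier-free language with the epsilon symbol, over the function and
predicate symbols of `L`, defined simultaneously. Expressions are taken up to renaming of bound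
variables, by de Bruijn indices: inside `eps A` the index `0` is the variable bound by this epsilon
and the index `k + 1` is the variable `k` of the surrounding expression. An index that points beyond
all binders around it is a free variable, so the free variables are numbered by `ℕ`. -/
mutual
inductive Tm (L : FirstOrder.Language.{u, v}) : Type (max u v)
  | var : ℕ → Tm L
  | func : {n : ℕ} → L.Functions n → (Fin n → Tm L) → Tm L
  | eps : Fm L → Tm L
inductive Fm (L : FirstOrder.Language.{u, v}) : Type (max u v)
  | rel : {n : ℕ} → L.Relations n → (Fin n → Tm L) → Fm L
  | top : Fm L
  | bot : Fm L
  | neg : Fm L → Fm L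
  | and : Fm L → Fm L → Fm L
  | or : Fm L → Fm L → Fm L
  | imp : Fm L → Fm L → Fm L
  | iff : Fm L → Fm L → Fm L
end

variable {L : FirstOrder.Language.{u, v}}

/- `t.HasFree k`: the variable `k` occurs free in `t`. -/
mutual
def Tm.HasFree : Tm L → ℕ → Prop
  | .var m, k => m = k
  | .func _ ts, k => ∃ i, (ts i).HasFree k
  | .eps A, k => A.HasFree (k + 1)
def Fm.HasFree : Fm L → ℕ → Prop
  | .rel _ ts, k => ∃ i, (ts i).HasFree k
  | .top, _ => False
  | .bot, _ => False
  | .neg A, k => A.HasFree k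
  | .and A B, k => A.HasFree k ∨ B.HasFree k
  | .or A B, k => A.HasFree k ∨ B.HasFree k
  | .imp A B, k => A.HasFree k ∨ B.HasFree k
  | .iff A B, k => A.HasFree k ∨ B.HasFree k
end

/- Well-formedness: the expression `eps A` counts as a term only if the variable that it binds has a
free occurrence in `A`. -/
mutual
def Tm.WF : Tm L → Prop
  | .var _ => True
  | .func _ ts => ∀ i, (ts i).WF
  | .eps A => A.WF ∧ A.HasFree 0
def Fm.WF : Fm L → Prop
  | .rel _ ts => ∀ i, (ts i).WF
  | .top => True
  | .bot => True
  | .neg A => A.WF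
  | .and A B => A.WF ∧ B.WF
  | .or A B => A.WF ∧ B.WF
  | .imp A B => A.WF ∧ B.WF
  | .iff A B => A.WF ∧ B.WF
end

/- Expressions of the elementary language: those without the epsilon symbol. -/
mutual
def Tm.EpsFree : Tm L → Prop
  | .var _ => True
  | .func _ ts => ∀ i, (ts i).EpsFree
  | .eps _ => False
def Fm.EpsFree : Fm L → Prop
  | .rel _ ts => ∀ i, (ts i).EpsFree
  | .top => True
  | .bot => True
  | .neg A => A.EpsFree
  | .and A B => A.EpsFree ∧ B.EpsFree
  | .or A B => A.EpsFree ∧ B.EpsFree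
  | .imp A B => A.EpsFree ∧ B.EpsFree
  | .iff A B => A.EpsFree ∧ B.EpsFree
end

/-- `t` is an epsilon-term. -/
def Tm.IsEpsTerm (t : Tm L) : Prop := t.WF ∧ ∃ A, t = .eps A

/-- Extend a renaming of variables under a binder. -/
def upRen (ρ : ℕ → ℕ) : ℕ → ℕ
  | 0 => 0
  | k + 1 => ρ k + 1

/- Renaming of free variables. -/
mutual
def Tm.rename : (ℕ → ℕ) → Tm L → Tm L
  | ρ, .var k => .var (ρ k)
  | ρ, .func f ts => .func f fun i => (ts i).rename ρ
  | ρ, .eps A => .eps (A.rename (upRen ρ))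
def Fm.rename : (ℕ → ℕ) → Fm L → Fm L
  | ρ, .rel R ts => .rel R fun i => (ts i).rename ρ
  | _, .top => .top
  | _, .bot => .bot
  | ρ, .neg A => .neg (A.rename ρ)
  | ρ, .and A B => .and (A.rename ρ) (B.rename ρ)
  | ρ, .or A B => .or (A.rename ρ) (B.rename ρ)
  | ρ, .imp A B => .imp (A.rename ρ) (B.rename ρ)
  | ρ, .iff A B => .iff (A.rename ρ) (B.rename ρ)
end

/-- Extend a substitution under a binder. -/
def upSubst (σ : ℕ → Tm L) : ℕ → Tm L
  | 0 => .var 0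
  | k + 1 => (σ k).rename Nat.succ

/- Simultaneous capture-avoiding substitution of `σ k` for every free variable `k`. -/
mutual
def Tm.subst : (ℕ → Tm L) → Tm L → Tm L
  | σ, .var k => σ k
  | σ, .func f ts => .func f fun i => (ts i).subst σ
  | σ, .eps A => .eps (A.subst (upSubst σ))
def Fm.subst : (ℕ → Tm L) → Fm L → Fm L
  | σ, .rel R ts => .rel R fun i => (ts i).subst σ
  | _, .top => .top
  | _, .bot => .bot
  | σ, .neg A => .neg (A.subst σ)
  | σ, .and A B => .and (A.subst σ) (B.subst σ)
  | σ, .or A B => .or (A.subst σ) (B.subst σ)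
  | σ, .imp A B => .imp (A.subst σ) (B.subst σ)
  | σ, .iff A B => .iff (A.subst σ) (B.subst σ)
end

/-- `A(t)`, for a formula `A(x)` which is the body of a binder (so `x` is the index `0`). -/
def Fm.inst (A : Fm L) (t : Tm L) : Fm L :=
  A.subst fun | 0 => t | k + 1 => .var k

/-- `E(s₁, …, sₙ)`: simultaneous substitution of the terms `s i` for the (pairwise distinct) free
variables `x i`; all other variables stay. -/
noncomputable def Fm.instVars {n : ℕ} (E : Fm L) (x : Fin n → ℕ) (s : Fin n → Tm L) : Fm L :=
  E.subst (Function.extend x s Tm.var)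

/-- Truth value of a formula when `v` gives the truth values of the atomic formulas. -/
def Fm.eval (v : (n : ℕ) → L.Relations n → (Fin n → Tm L) → Prop) : Fm L → Prop
  | .rel (n := n) R ts => v n R ts
  | .top => True
  | .bot => False
  | .neg A => ¬ A.eval v
  | .and A B => A.eval v ∧ B.eval v
  | .or A B => A.eval v ∨ B.eval v
  | .imp A B => A.eval v → B.eval v
  | .iff A B => A.eval v ↔ B.eval v

/-- Propositional tautologies. -/
def Fm.Taut (A : Fm L) : Prop := ∀ v, A.eval v

/-- Axioms of the elementary calculus EC: the tautologies of the epsilon-free language. -/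
def axEC (L : FirstOrder.Language.{u, v}) : Set (Fm L) := {A | A.EpsFree ∧ A.Taut}

/-- Critical formulas `A(t) → A(ε x A(x))`. -/
def critical (L : FirstOrder.Language.{u, v}) : Set (Fm L) :=
  {C | ∃ (A : Fm L) (t : Tm L), (Tm.eps A).WF ∧ t.WF ∧ C = .imp (A.inst t) (A.inst (.eps A))}

/-- Axioms of the (intensional) epsilon-calculus without identity: the tautologies of the language
with epsilon and the critical formulas. -/
def axECeps (L : FirstOrder.Language.{u, v}) : Set (Fm L) := {A | A.WF ∧ A.Taut} ∪ critical L

/-- `π` is a proof of `A` from the axioms `Ax`: a finite sequence of formulas with last member `A`,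
each of which is an axiom or follows from two earlier ones by modus ponens. (The conclusion of modus
ponens is a subformula of a premise, so all members belong to the language of the axioms.) -/
def IsProof (Ax : Set (Fm L)) (π : List (Fm L)) (A : Fm L) : Prop :=
  π.getLast? = some A ∧
    ∀ (i : ℕ) (hi : i < π.length), π[i] ∈ Ax ∨
      ∃ (j k : ℕ) (hj : j < i) (hk : k < i), π[k] = .imp π[j] π[i]

def Provable (Ax : Set (Fm L)) (A : Fm L) : Prop := ∃ π, IsProof Ax π A

/-- Finite disjunctions; the disjunction of one formula is that formula. -/
def bigOr : List (Fm L) → Fm L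
  | [] => .bot
  | [A] => A
  | A :: B :: l => .or A (bigOr (B :: l))

end EpsCalc

namespace EpsCalc

open FirstOrder.Language

variable {L : FirstOrder.Language.{u, v}}

-- The argument is semantic. Reading `eps` as a choice operator makes every theorem of the
-- ε-calculus true in every nonempty structure (`sat_of_provable`). A valuation `w` of the atomic
-- formulas turns the set of ε-free terms into such a structure, where truth of an ε-free formula is
-- truth under `w` of a substitution instance. In it the `e i` have ε-free terms as values, so `w`
-- makes some ε-free instance of `E` true (`exists_eval_instVars`). By propositional compactness
-- (`exists_falsifying_valuation`) finitely many instances serve all valuations; their disjunction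
-- is a tautology, hence an axiom of EC. No bound on the number of disjuncts results.

/-- Prepend a value to an assignment. -/
def push {M : Type*} (a : M) (ρ : ℕ → M) : ℕ → M
  | 0 => a
  | k + 1 => ρ k

theorem push_comp_upRen {M : Type*} (a : M) (ρ : ℕ → M) (r : ℕ → ℕ) :
    (fun k => push a ρ (upRen r k)) = push a fun k => ρ (r k) := by
  funext k; cases k <;> rfl

-- Soundness of the ε-calculus for choice semantics

section Semantics

variable {M : Type*} [L.Structure M] [Nonempty M]

/- Value of terms and truth of formulas in a first-order structure; the epsilon symbol is read as a
choice operator. -/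
mutual
noncomputable def Tm.val : Tm L → (ℕ → M) → M
  | .var k, ρ => ρ k
  | .func f ts, ρ => Structure.funMap f fun i => (ts i).val ρ
  | .eps A, ρ => Classical.epsilon fun a => push a ρ ∈ A.truths
noncomputable def Fm.truths : Fm L → Set (ℕ → M)
  | .rel R ts => {ρ | Structure.RelMap R fun i => (ts i).val ρ}
  | .top => Set.univ
  | .bot => ∅
  | .neg A => {ρ | ρ ∉ A.truths}
  | .and A B => {ρ | ρ ∈ A.truths ∧ ρ ∈ B.truths}
  | .or A B => {ρ | ρ ∈ A.truths ∨ ρ ∈ B.truths}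
  | .imp A B => {ρ | ρ ∈ A.truths → ρ ∈ B.truths}
  | .iff A B => {ρ | ρ ∈ A.truths ↔ ρ ∈ B.truths}
end

/-- The formula `A` is true under the assignment `ρ`. -/
def Fm.sat (A : Fm L) (ρ : ℕ → M) : Prop := ρ ∈ A.truths

section Clauses

variable (ρ : ℕ → M) (A B : Fm L)

theorem Tm.val_eps : (Tm.eps A).val ρ = Classical.epsilon fun a => A.sat (push a ρ) := by
  simp only [Tm.val, Fm.sat]

theorem Fm.sat_rel {n : ℕ} (R : L.Relations n) (ts : Fin n → Tm L) :
    (Fm.rel R ts).sat ρ = Structure.RelMap R fun i => (ts i).val ρ := by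
  simp only [Fm.sat, Fm.truths, Set.mem_ofPred_eq]

theorem Fm.sat_top : (Fm.top : Fm L).sat ρ = True := by
  simp only [Fm.sat, Fm.truths, Set.mem_univ]

theorem Fm.sat_bot : (Fm.bot : Fm L).sat ρ = False := by
  simp only [Fm.sat, Fm.truths, Set.mem_empty_iff_false]

theorem Fm.sat_neg : (Fm.neg A).sat ρ = ¬ A.sat ρ := by
  simp only [Fm.sat, Fm.truths, Set.mem_ofPred_eq]

theorem Fm.sat_and : (Fm.and A B).sat ρ = (A.sat ρ ∧ B.sat ρ) := by
  simp only [Fm.sat, Fm.truths, Set.mem_ofPred_eq]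

theorem Fm.sat_or : (Fm.or A B).sat ρ = (A.sat ρ ∨ B.sat ρ) := by
  simp only [Fm.sat, Fm.truths, Set.mem_ofPred_eq]

theorem Fm.sat_imp : (Fm.imp A B).sat ρ = (A.sat ρ → B.sat ρ) := by
  simp only [Fm.sat, Fm.truths, Set.mem_ofPred_eq]

theorem Fm.sat_iff : (Fm.iff A B).sat ρ = (A.sat ρ ↔ B.sat ρ) := by
  simp only [Fm.sat, Fm.truths, Set.mem_ofPred_eq]

end Clauses

mutual
theorem Tm.val_rename : ∀ (t : Tm L) (r : ℕ → ℕ) (ρ : ℕ → M),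
    (t.rename r).val ρ = t.val fun k => ρ (r k)
  | .var k, r, ρ => by simp [Tm.rename, Tm.val]
  | .func f ts, r, ρ => by
    simp only [Tm.rename, Tm.val]
    congr 1; funext i; exact (ts i).val_rename r ρ
  | .eps A, r, ρ => by
    simp only [Tm.rename, Tm.val_eps]
    congr 1; funext a; rw [A.sat_rename, push_comp_upRen]
theorem Fm.sat_rename : ∀ (A : Fm L) (r : ℕ → ℕ) (ρ : ℕ → M),
    (A.rename r).sat ρ = A.sat fun k => ρ (r k)
  | .rel R ts, r, ρ => by
    simp only [Fm.rename, Fm.sat_rel]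
    congr 1; funext i; exact (ts i).val_rename r ρ
  | .top, r, ρ => by simp only [Fm.rename, Fm.sat_top]
  | .bot, r, ρ => by simp only [Fm.rename, Fm.sat_bot]
  | .neg A, r, ρ => by simp only [Fm.rename, Fm.sat_neg, A.sat_rename r ρ]
  | .and A B, r, ρ => by simp only [Fm.rename, Fm.sat_and, A.sat_rename r ρ, B.sat_rename r ρ]
  | .or A B, r, ρ => by simp only [Fm.rename, Fm.sat_or, A.sat_rename r ρ, B.sat_rename r ρ]
  | .imp A B, r, ρ => by simp only [Fm.rename, Fm.sat_imp, A.sat_rename r ρ, B.sat_rename r ρ]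
  | .iff A B, r, ρ => by simp only [Fm.rename, Fm.sat_iff, A.sat_rename r ρ, B.sat_rename r ρ]
end

/-- The binder case of the substitution lemma: the lifted terms are renamed past index `0`, so they
do not see `a`. -/
theorem val_upSubst (a : M) (ρ : ℕ → M) (σ : ℕ → Tm L) :
    (fun k => (upSubst σ k).val (push a ρ)) = push a fun k => (σ k).val ρ := by
  funext k
  cases k with
  | zero => simp [upSubst, Tm.val, push]
  | succ k => simp only [upSubst, Tm.val_rename, push]

mutual
theorem Tm.val_subst : ∀ (t : Tm L) (σ : ℕ → Tm L) (ρ : ℕ → M),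
    (t.subst σ).val ρ = t.val fun k => (σ k).val ρ
  | .var k, σ, ρ => by simp [Tm.subst, Tm.val]
  | .func f ts, σ, ρ => by
    simp only [Tm.subst, Tm.val]
    congr 1; funext i; exact (ts i).val_subst σ ρ
  | .eps A, σ, ρ => by
    simp only [Tm.subst, Tm.val_eps]
    congr 1; funext a; rw [A.sat_subst, val_upSubst]
theorem Fm.sat_subst : ∀ (A : Fm L) (σ : ℕ → Tm L) (ρ : ℕ → M),
    (A.subst σ).sat ρ = A.sat fun k => (σ k).val ρ
  | .rel R ts, σ, ρ => by
    simp only [Fm.subst, Fm.sat_rel]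
    congr 1; funext i; exact (ts i).val_subst σ ρ
  | .top, σ, ρ => by simp only [Fm.subst, Fm.sat_top]
  | .bot, σ, ρ => by simp only [Fm.subst, Fm.sat_bot]
  | .neg A, σ, ρ => by simp only [Fm.subst, Fm.sat_neg, A.sat_subst σ ρ]
  | .and A B, σ, ρ => by simp only [Fm.subst, Fm.sat_and, A.sat_subst σ ρ, B.sat_subst σ ρ]
  | .or A B, σ, ρ => by simp only [Fm.subst, Fm.sat_or, A.sat_subst σ ρ, B.sat_subst σ ρ]
  | .imp A B, σ, ρ => by simp only [Fm.subst, Fm.sat_imp, A.sat_subst σ ρ, B.sat_subst σ ρ]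
  | .iff A B, σ, ρ => by simp only [Fm.subst, Fm.sat_iff, A.sat_subst σ ρ, B.sat_subst σ ρ]
end

theorem Fm.sat_inst (A : Fm L) (t : Tm L) (ρ : ℕ → M) :
    (A.inst t).sat ρ = A.sat (push (t.val ρ) ρ) := by
  rw [Fm.inst, Fm.sat_subst]
  congr 1; funext k
  cases k <;> simp [Tm.val, push]

/-- Makes tautologies true in every structure. Propositional evaluation never looks inside terms,
hence the trivial motive for them. -/
theorem Fm.sat_iff_eval (A : Fm L) (ρ : ℕ → M) :
    A.sat ρ ↔ A.eval fun _ R ts => Structure.RelMap R fun i => (ts i).val ρ := by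
  induction A using Fm.rec (motive_1 := fun _ => True) with
  | var | func | eps => trivial
  | rel | top | bot => simp only [Fm.sat_rel, Fm.sat_top, Fm.sat_bot, Fm.eval]
  | neg A hA => simp only [Fm.sat_neg, Fm.eval, hA]
  | and A B hA hB | or A B hA hB | imp A B hA hB | iff A B hA hB =>
    simp only [Fm.sat_and, Fm.sat_or, Fm.sat_imp, Fm.sat_iff, Fm.eval, hA, hB]

theorem sat_of_mem_axECeps {A : Fm L} (hA : A ∈ axECeps L) (ρ : ℕ → M) : A.sat ρ := by
  rcases hA with ⟨-, hA⟩ | ⟨A, t, -, -, rfl⟩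
  · exact (A.sat_iff_eval ρ).2 (hA _)
  · simp only [Fm.sat_imp, Fm.sat_inst, Tm.val_eps]
    -- The value of `t` is the witness that obliges the choice operator to succeed.
    exact fun h => Classical.epsilon_spec (p := fun a => A.sat (push a ρ)) ⟨_, h⟩

theorem sat_of_provable {A : Fm L} (hA : Provable (axECeps L) A) (ρ : ℕ → M) : A.sat ρ := by
  obtain ⟨π, hlast, hπ⟩ := hA
  have key : ∀ (i : ℕ) (hi : i < π.length), π[i].sat ρ := by
    intro i
    induction i using Nat.strong_induction_on with
    | _ i ih =>
      intro hi
      rcases hπ i hi with hax | ⟨j, k, hj, hk, hjk⟩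
      · exact sat_of_mem_axECeps hax ρ
      · have h := ih k hk (hk.trans hi)
        rw [hjk, Fm.sat_imp] at h
        exact h (ih j hj (hj.trans hi))
  obtain ⟨i, hi, rfl⟩ := List.getElem_of_mem (List.mem_of_getLast? hlast)
  exact key i hi

end Semantics

-- Propositional compactness

section Propositional

open Filter

/-- Truth values for the atomic formulas. -/
abbrev Valuation (L : FirstOrder.Language.{u, v}) :=
  (n : ℕ) → L.Relations n → (Fin n → Tm L) → Prop

/-- The propositional form of Łoś's theorem: membership in an ultrafilter commutes with all
connectives. -/
theorem Fm.eval_ultrafilter (U : Ultrafilter (Valuation L)) (A : Fm L) :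
    A.eval (fun n R ts => ∀ᶠ w : Valuation L in U, w n R ts) ↔ ∀ᶠ w in U, A.eval w := by
  induction A using Fm.rec (motive_1 := fun _ => True) with
  | var | func | eps => trivial
  | rel | top | bot => simp [Fm.eval, U.neBot.ne]
  | neg A hA => simp only [Fm.eval, hA, Ultrafilter.eventually_not]
  | and A B hA hB => simp only [Fm.eval, hA, hB, eventually_and]
  | or A B hA hB => simp only [Fm.eval, hA, hB, Ultrafilter.eventually_or]
  | imp A B hA hB => simp only [Fm.eval, hA, hB, Ultrafilter.eventually_imp]
  | iff A B hA hB =>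
    simp only [Fm.eval, hA, hB, iff_iff_implies_and_implies, eventually_and,
      Ultrafilter.eventually_imp]

/-- Compactness: formulas any finitely many of which can be falsified together can all be falsified
together. -/
theorem exists_falsifying_valuation {ι : Type*} (F : ι → Fm L)
    (h : ∀ l : List ι, ∃ w : Valuation L, ∀ i ∈ l, ¬ (F i).eval w) :
    ∃ w : Valuation L, ∀ i, ¬ (F i).eval w := by
  classical
  -- The valuations falsifying a finite subfamily generate a proper filter: the sets are nonempty by
  -- `h` and directed under unions of index sets. The limit along a finer ultrafilter falsifies
  -- every `F i`.
  have hne : (⨅ s : Finset ι, 𝓟 {w : Valuation L | ∀ i ∈ s, ¬ (F i).eval w}).NeBot := by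
    refine iInf_neBot_of_directed' ?_ fun s => ?_
    · intro s t
      refine ⟨s ∪ t, ?_, ?_⟩ <;> simp only [ge_iff_le, le_principal_iff, mem_principal] <;>
        intro w hw i hi <;> exact hw i (by simp [hi])
    · obtain ⟨w, hw⟩ := h s.toList
      exact principal_neBot_iff.2 ⟨w, fun i hi => hw i (by simpa using hi)⟩
  obtain ⟨U, hU⟩ := Ultrafilter.exists_le _ (h := hne)
  refine ⟨fun n R ts => ∀ᶠ w : Valuation L in U, w n R ts, fun i => ?_⟩
  rw [Fm.eval_ultrafilter, ← Ultrafilter.eventually_not]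
  apply hU
  refine mem_iInf_of_mem {i} ?_
  simp

theorem eval_bigOr (w : Valuation L) : ∀ l : List (Fm L), (bigOr l).eval w ↔ ∃ A ∈ l, A.eval w
  | [] => by simp [bigOr, Fm.eval]
  | [A] => by simp [bigOr]
  | A :: B :: l => by simp [bigOr, Fm.eval, eval_bigOr w (B :: l)]

theorem epsFree_bigOr : ∀ l : List (Fm L), (∀ A ∈ l, A.EpsFree) → (bigOr l).EpsFree
  | [], _ => by simp [bigOr, Fm.EpsFree]
  | [A], h => by simpa [bigOr] using h
  | A :: B :: l, h => by
    simp only [bigOr, Fm.EpsFree]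
    exact ⟨h A (by simp), epsFree_bigOr (B :: l) fun C hC => h C (List.mem_cons_of_mem _ hC)⟩

theorem provable_of_mem {Ax : Set (Fm L)} {A : Fm L} (hA : A ∈ Ax) : Provable Ax A := by
  refine ⟨[A], rfl, fun i hi => Or.inl ?_⟩
  simpa using hA

end Propositional

-- Term models on the ε-free terms

section EpsFree

mutual
theorem Tm.EpsFree.subst {σ : ℕ → Tm L} (hσ : ∀ k, (σ k).EpsFree) :
    ∀ t : Tm L, t.EpsFree → (t.subst σ).EpsFree
  | .var k, _ => by simpa only [Tm.subst] using hσ k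
  | .func f ts, h => by
    simp only [Tm.subst, Tm.EpsFree] at h ⊢
    exact fun i => Tm.EpsFree.subst hσ (ts i) (h i)
  | .eps A, h => by simp only [Tm.EpsFree] at h
theorem Fm.EpsFree.subst {σ : ℕ → Tm L} (hσ : ∀ k, (σ k).EpsFree) :
    ∀ A : Fm L, A.EpsFree → (A.subst σ).EpsFree
  | .rel R ts, h => by
    simp only [Fm.subst, Fm.EpsFree] at h ⊢
    exact fun i => Tm.EpsFree.subst hσ (ts i) (h i)
  | .top, _ => by simp only [Fm.subst, Fm.EpsFree]
  | .bot, _ => by simp only [Fm.subst, Fm.EpsFree]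
  | .neg A, h => by
    simp only [Fm.subst, Fm.EpsFree] at h ⊢
    exact Fm.EpsFree.subst hσ A h
  | .and A B, h => by
    simp only [Fm.subst, Fm.EpsFree] at h ⊢
    exact ⟨Fm.EpsFree.subst hσ A h.1, Fm.EpsFree.subst hσ B h.2⟩
  | .or A B, h => by
    simp only [Fm.subst, Fm.EpsFree] at h ⊢
    exact ⟨Fm.EpsFree.subst hσ A h.1, Fm.EpsFree.subst hσ B h.2⟩
  | .imp A B, h => by
    simp only [Fm.subst, Fm.EpsFree] at h ⊢
    exact ⟨Fm.EpsFree.subst hσ A h.1, Fm.EpsFree.subst hσ B h.2⟩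
  | .iff A B, h => by
    simp only [Fm.subst, Fm.EpsFree] at h ⊢
    exact ⟨Fm.EpsFree.subst hσ A h.1, Fm.EpsFree.subst hσ B h.2⟩
end

theorem Fm.EpsFree.instVars {n : ℕ} {E : Fm L} (hE : E.EpsFree) {x : Fin n → ℕ}
    (hx : Function.Injective x) {s : Fin n → Tm L} (hs : ∀ i, (s i).EpsFree) :
    (E.instVars x s).EpsFree := by
  refine Fm.EpsFree.subst (fun k => ?_) E hE
  by_cases hk : ∃ i, x i = k
  · obtain ⟨i, rfl⟩ := hk
    rw [hx.extend_apply]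
    exact hs i
  · rw [Function.extend_apply' _ _ _ hk]
    simp only [Tm.EpsFree]

/-- The terms of the elementary language. -/
abbrev ETm (L : FirstOrder.Language.{u, v}) := {t : Tm L // t.EpsFree}

/-- The choice operator needs a nonempty domain; variables provide one even without constants. -/
instance : Nonempty (ETm L) := ⟨⟨.var 0, by simp only [Tm.EpsFree]⟩⟩

/-- The term model of a valuation. -/
abbrev termModel (w : Valuation L) : L.Structure (ETm L) where
  funMap f ts := ⟨.func f fun i => (ts i).1, by simpa only [Tm.EpsFree] using fun i => (ts i).2⟩
  RelMap R ts := w _ R fun i => (ts i).1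

/-- Evaluation is substitution here because function symbols act as term constructors; on ε-terms,
whose values are chosen, this would fail. -/
theorem val_termModel (w : Valuation L) (ρ : ℕ → ETm L) : ∀ t : Tm L, t.EpsFree →
    letI := termModel w
    (t.val ρ).1 = t.subst fun k => (ρ k).1
  | .var k, _ => by simp only [Tm.val, Tm.subst]
  | .func f ts, h => by
    simp only [Tm.EpsFree] at h
    simp only [Tm.val, Tm.subst]
    exact congrArg (Tm.func f) (funext fun i => val_termModel w ρ (ts i) (h i))
  | .eps A, h => by simp only [Tm.EpsFree] at h

theorem sat_termModel (w : Valuation L) (ρ : ℕ → ETm L) (A : Fm L) (hA : A.EpsFree) :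
    letI := termModel w
    A.sat ρ ↔ (A.subst fun k => (ρ k).1).eval w := by
  induction A using Fm.rec (motive_1 := fun _ => True) with
  | var | func | eps => trivial
  | rel R ts =>
    simp only [Fm.EpsFree] at hA
    simp only [Fm.sat_rel, Fm.subst, Fm.eval]
    have : (fun i => (ts i).subst fun k => (ρ k).1) =
        fun i => (letI := termModel w; ((ts i).val ρ).1) :=
      funext fun i => (val_termModel w ρ (ts i) (hA i)).symm
    rw [this]
    rfl
  | top | bot => simp only [Fm.sat_top, Fm.sat_bot, Fm.subst, Fm.eval]
  | neg A ihA =>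
    simp only [Fm.EpsFree] at hA
    simp only [Fm.sat_neg, Fm.subst, Fm.eval, ihA hA]
  | and A B ihA ihB | or A B ihA ihB | imp A B ihA ihB | iff A B ihA ihB =>
    simp only [Fm.EpsFree] at hA
    simp only [Fm.sat_and, Fm.sat_or, Fm.sat_imp, Fm.sat_iff, Fm.subst, Fm.eval,
      ihA hA.1, ihB hA.2]

/-- Under every valuation, a provable instance of an epsilon-free formula has a true instance by
epsilon-free terms. -/
theorem exists_eval_instVars {n : ℕ} {E : Fm L} (hE : E.EpsFree) {x : Fin n → ℕ}
    (hx : Function.Injective x) {e : Fin n → Tm L}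
    (h : Provable (axECeps L) (E.instVars x e)) (w : Valuation L) :
    ∃ t : Fin n → ETm L, (E.instVars x fun i => (t i).1).eval w := by
  let _ := termModel w
  -- Each variable denotes itself, so the variables of `E` outside the range of `x` stay unchanged.
  let ρ : ℕ → ETm L := fun k => ⟨.var k, by simp only [Tm.EpsFree]⟩
  have hsat := sat_of_provable h ρ
  rw [Fm.instVars, Fm.sat_subst, sat_termModel w _ E hE] at hsat
  refine ⟨fun i => (e i).val ρ, ?_⟩
  convert hsat using 2
  rw [Fm.instVars]
  congr 1
  funext k
  by_cases hk : ∃ i, x i = k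
  · obtain ⟨i, rfl⟩ := hk
    rw [hx.extend_apply, hx.extend_apply]
  · rw [Function.extend_apply' _ _ _ hk, Function.extend_apply' _ _ _ hk]
    simp only [Tm.val, ρ]

end EpsFree

end EpsCalc

-- The extended first ε-theorem

theorem mainTheorem3 {L : FirstOrder.Language.{u, v}} {n : ℕ}
    (E : EpsCalc.Fm L) (hE : E.EpsFree)
    (x : Fin n → ℕ) (hx : Function.Injective x)
    (e : Fin n → EpsCalc.Tm L) (he : ∀ i, (e i).IsEpsTerm)
    (h : EpsCalc.Provable (EpsCalc.axECeps L) (E.instVars x e)) :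
    ∃ ts : List (Fin n → EpsCalc.Tm L), ts ≠ [] ∧
      (∀ t ∈ ts, ∀ i, (t i).EpsFree) ∧
      EpsCalc.Provable (EpsCalc.axEC L) (EpsCalc.bigOr (ts.map fun t => E.instVars x t)) := by
  have hfin : ∃ l : List (Fin n → EpsCalc.ETm L), ∀ w : EpsCalc.Valuation L,
      ∃ t ∈ l, (E.instVars x fun i => (t i).1).eval w := by
    by_contra! hl
    obtain ⟨w, hw⟩ := EpsCalc.exists_falsifying_valuation
      (fun t : Fin n → EpsCalc.ETm L => E.instVars x fun i => (t i).1) hl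
    obtain ⟨t, ht⟩ := EpsCalc.exists_eval_instVars hE hx h w
    exact hw t ht
  obtain ⟨l, hl⟩ := hfin
  refine ⟨l.map fun t i => (t i).1, ?_, ?_, EpsCalc.provable_of_mem ⟨?_, fun w => ?_⟩⟩
  -- Any valuation would do: each one needs a member of `l`.
  · obtain ⟨t, ht, -⟩ := hl fun _ _ _ => True
    simpa using List.ne_nil_of_mem ht
  · simp only [List.mem_map]
    rintro _ ⟨t, -, rfl⟩ i
    exact (t i).2
  · refine EpsCalc.epsFree_bigOr _ ?_
    simp only [List.map_map, List.mem_map]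
    rintro _ ⟨t, -, rfl⟩
    exact hE.instVars hx fun i => (t i).2
  · obtain ⟨t, ht, hw⟩ := hl w
    rw [EpsCalc.eval_bigOr]
    exact ⟨_, List.mem_map_of_mem (List.mem_map_of_mem ht), hw⟩
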